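/- Let $k\ge 1$ and let $N=\mathbb{C}^k$ with coordinates $\sigma_1,\dots,\sigma_k$. Let $D_N$ be the sheaf of holomorphic differential operators on $N$, put $\partial_h=\partial/\partial\sigma_h$, and $$E=\sum_{h=1}^k\sigma_h\partial_h,\qquad U_0=\sum_{h=1}^k h\,\sigma_h\partial_h .$$ For $\mu\in\mathbb{C}$ let $\mathcal{I}_\mu$ be the sheaf of left ideals of $D_N$ generated by the operators $\partial_i\partial_j-\partial_{i+1}\partial_{j-1}$ ($1\le i\le k-1$, $2\le j\le k$) and $\partial_1\partial_{m-1}+\partial_m(E+\mu)$ ($2\le m\le k$). For $\lambda\in\mathbb{C}$ let $\mathcal{N}_{\mu,\lambda}$ be the sheaf of left $D_N$-modules $$\mathcal{N}_{\mu,\lambda}=D_N\big/\big(\mathcal{I}_\mu+D_N(U_0-\lambda)\big).$$ **Theorem (periodicity in $\mu$).** Let $\mu,\lambda\in\mathbb{C}$ with $\mu\neq 0$, $\lambda\notin\mathbb{N}=\{0,1,2,\dots\}$ and $\lambda+k\mu\notin\{0,-1,\dots,-(k-1)\}$. Then right multiplication by $E+\mu$, that is $[P]\mapsto[P(E+\mu)]$,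 induces a well-defined isomorphism of sheaves of left $D_N$-modules $$\mathcal{N}_{\mu+1,\lambda}\longrightarrow\mathcal{N}_{\mu,\lambda}.$$ -/

import Mathlib

open scoped Topology

noncomputable section

namespace MuTrace

/-- The base manifold `N = ℂ^k`; the coordinate `σ_h` (`1 ≤ h ≤ k`) is the entry of index `h - 1`. -/
abbrev Base (k : ℕ) : Type := Fin k → ℂ

instance germAlgebra (k : ℕ) (x : Base k) : Algebra ℂ ((𝓝 x).Germ ℂ) :=
  Algebra.ofModule
    (by rintro r ⟨f⟩ ⟨g⟩
        exact congrArg (Filter.Germ.ofFun (l := 𝓝 x)) (smul_mul_assoc r f g))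
    (by rintro r ⟨f⟩ ⟨g⟩
        exact congrArg (Filter.Germ.ofFun (l := 𝓝 x)) (mul_smul_comm r f g))

/-- The algebra of germs at `x` of holomorphic functions, inside the germs of all functions. -/
def holSub {k : ℕ} (x : Base k) : Subalgebra ℂ ((𝓝 x).Germ ℂ) where
  carrier := {φ | ∃ f : Base k → ℂ, AnalyticAt ℂ f x ∧ (f : (𝓝 x).Germ ℂ) = φ}
  mul_mem' := by
    rintro _ _ ⟨f, hf, rfl⟩ ⟨g, hg, rfl⟩
    exact ⟨f * g, hf.mul hg, rfl⟩
  add_mem' := by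
    rintro _ _ ⟨f, hf, rfl⟩ ⟨g, hg, rfl⟩
    exact ⟨f + g, hf.add hg, rfl⟩
  algebraMap_mem' := by
    intro r
    refine ⟨r • (1 : Base k → ℂ), analyticAt_const.const_smul, ?_⟩
    rw [Algebra.algebraMap_eq_smul_one]
    rfl

/-- The ring `𝒪_{N,x}` of germs at `x` of holomorphic functions. -/
def HolGerm {k : ℕ} (x : Base k) : Type := holSub x

instance {k : ℕ} (x : Base k) : CommRing (HolGerm x) := inferInstanceAs (CommRing (holSub x))

instance {k : ℕ} (x : Base k) : Algebra ℂ (HolGerm x) := inferInstanceAs (Algebra ℂ (holSub x))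

/-- The germ at `x` of a function that is holomorphic near `x`. -/
def germ {k : ℕ} (x : Base k) (f : Base k → ℂ) (hf : AnalyticAt ℂ f x) : HolGerm x :=
  ⟨f, f, hf, rfl⟩

/-- The partial derivative of a function in the direction of the `i`-th coordinate. -/
def pderivFun {k : ℕ} (i : Fin k) (f : Base k → ℂ) : Base k → ℂ :=
  fun y => fderiv ℂ f y (Pi.single i 1)

/-- The partial derivative of a germ of function. -/
def pderivGerm {k : ℕ} (x : Base k) (i : Fin k) : (𝓝 x).Germ ℂ → (𝓝 x).Germ ℂ :=
  Quotient.map' (pderivFun i) (fun _ _ h => (Filter.EventuallyEq.fderiv (𝕜 := ℂ) h).mono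
    (fun _ hy => congrArg (fun L : Base k →L[ℂ] ℂ => L (Pi.single i 1)) hy))

theorem analyticAt_pderivFun {k : ℕ} {x : Base k} (i : Fin k) {f : Base k → ℂ}
    (hf : AnalyticAt ℂ f x) : AnalyticAt ℂ (pderivFun i f) x :=
  ((ContinuousLinearMap.apply ℂ ℂ (Pi.single i (1 : ℂ) : Base k)).analyticAt _).comp hf.fderiv

/-- The derivation `∂/∂x_i` of `𝒪_{N,x}`. -/
def pderiv {k : ℕ} (x : Base k) (i : Fin k) : Module.End ℂ (HolGerm x) where
  toFun φ := ⟨pderivGerm x i φ.1, by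
    obtain ⟨_, f, hf, rfl⟩ := φ
    exact ⟨pderivFun i f, analyticAt_pderivFun i hf, rfl⟩⟩
  map_add' := by
    rintro ⟨_, f, hf, rfl⟩ ⟨_, g, hg, rfl⟩
    refine Subtype.ext (Filter.Germ.coe_eq.2 ?_)
    filter_upwards [hf.eventually_analyticAt, hg.eventually_analyticAt] with y hy hy'
    change fderiv ℂ (f + g) y _ = _
    rw [fderiv_add hy.differentiableAt hy'.differentiableAt]
    rfl
  map_smul' := by
    rintro r ⟨_, f, hf, rfl⟩
    refine Subtype.ext (Filter.Germ.coe_eq.2 ?_)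
    filter_upwards [hf.eventually_analyticAt] with y hy
    change fderiv ℂ (r • f) y _ = _
    rw [fderiv_const_smul hy.differentiableAt]
    rfl

/-- The subalgebra of `End_ℂ(𝒪_{N,x})` generated by the multiplications by germs of holomorphic
functions and by the partial derivatives. -/
def diffOps {k : ℕ} (x : Base k) : Subalgebra ℂ (Module.End ℂ (HolGerm x)) :=
  Algebra.adjoin ℂ (Set.range (LinearMap.mulLeft ℂ) ∪ Set.range (pderiv x))

/-- The stalk `D_{N,x}`: the algebra of germs at `x` of holomorphic differential operators. -/
def DStalk {k : ℕ} (x : Base k) : Type := diffOps x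

instance {k : ℕ} (x : Base k) : Ring (DStalk x) := inferInstanceAs (Ring (diffOps x))

instance {k : ℕ} (x : Base k) : Algebra ℂ (DStalk x) := inferInstanceAs (Algebra ℂ (diffOps x))

/-- Multiplication by a germ of holomorphic function, as a differential operator of order `0`. -/
def mulOp {k : ℕ} (x : Base k) (φ : HolGerm x) : DStalk x :=
  ⟨LinearMap.mulLeft ℂ φ, Algebra.subset_adjoin (Or.inl ⟨φ, rfl⟩)⟩

/-- The partial derivative as a germ of differential operator. -/
def pderivOp {k : ℕ} (x : Base k) (i : Fin k) : DStalk x :=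
  ⟨pderiv x i, Algebra.subset_adjoin (Or.inr ⟨i, rfl⟩)⟩

theorem analyticAt_coord {k : ℕ} (x : Base k) (i : Fin k) :
    AnalyticAt ℂ (fun y : Base k => y i) x :=
  (ContinuousLinearMap.proj (R := ℂ) (φ := fun _ : Fin k => ℂ) i).analyticAt x

/-- The operator `∂_h = ∂/∂σ_h` for `1 ≤ h ≤ k` (only these `h` are used). -/
def del {k : ℕ} (x : Base k) (h : ℕ) : DStalk x :=
  if hh : 1 ≤ h ∧ h ≤ k then pderivOp x ⟨h - 1, by omega⟩ else 0

/-- Multiplication by the coordinate `σ_h` for `1 ≤ h ≤ k` (only these `h` are used). -/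
def sig {k : ℕ} (x : Base k) (h : ℕ) : DStalk x :=
  if hh : 1 ≤ h ∧ h ≤ k then mulOp x (germ x _ (analyticAt_coord x ⟨h - 1, by omega⟩)) else 0

/-- `E = ∑_{h=1}^k σ_h ∂_h`. -/
def opE {k : ℕ} (x : Base k) : DStalk x :=
  ∑ h ∈ Finset.Icc 1 k, sig x h * del x h

/-- `U_0 = ∑_{h=1}^k h σ_h ∂_h`. -/
def opU0 {k : ℕ} (x : Base k) : DStalk x :=
  ∑ h ∈ Finset.Icc 1 k, (h : ℂ) • (sig x h * del x h)

/-- `A_{i,j} = ∂_i ∂_j - ∂_{i+1} ∂_{j-1}`. -/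
def opA {k : ℕ} (x : Base k) (i j : ℕ) : DStalk x :=
  del x i * del x j - del x (i + 1) * del x (j - 1)

/-- `T^m_μ = ∂_1 ∂_{m-1} + ∂_m (E + μ)`. -/
def opT {k : ℕ} (μ : ℂ) (x : Base k) (m : ℕ) : DStalk x :=
  del x 1 * del x (m - 1) + del x m * (opE x + algebraMap ℂ (DStalk x) μ)

/-- The stalk at `x` of the left ideal `𝒜`, generated by the `A_{i,j}` for `i ∈ [1, k-1]` and
`j ∈ [2, k]`. -/
def idealA {k : ℕ} (x : Base k) : Submodule (DStalk x) (DStalk x) :=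
  Submodule.span (DStalk x) {P | ∃ i j : ℕ, 1 ≤ i ∧ i + 1 ≤ k ∧ 2 ≤ j ∧ j ≤ k ∧ P = opA x i j}

/-- The stalk at `x` of the left ideal `ℐ_μ = 𝒜 + ∑_{m=2}^k D_N T^m_μ`. -/
def idealI {k : ℕ} (μ : ℂ) (x : Base k) : Submodule (DStalk x) (DStalk x) :=
  idealA x ⊔ Submodule.span (DStalk x) {P | ∃ m : ℕ, 2 ≤ m ∧ m ≤ k ∧ P = opT μ x m}

/-- The stalk at `x` of the left ideal `𝒥_{μ,l} = ℐ_μ + D_N (U_0 - l)`. -/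
def idealJ {k : ℕ} (μ l : ℂ) (x : Base k) : Submodule (DStalk x) (DStalk x) :=
  idealI μ x ⊔ Submodule.span (DStalk x) {opU0 x - algebraMap ℂ (DStalk x) l}

/-- The stalk at `x` of the quotient sheaf `𝒩_{μ,l} = D_N / 𝒥_{μ,l}`. -/
abbrev NStalk {k : ℕ} (μ l : ℂ) (x : Base k) : Type := DStalk x ⧸ idealJ μ l x

/-- Differential operators on the open set `V` that are globally polynomial expressions in
functions holomorphic on `V` and in the partial derivatives, seen as families of germs. -/
def DPre {k : ℕ} (V : TopologicalSpace.Opens (Base k)) :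
    Subalgebra ℂ (∀ y : V, DStalk (y : Base k)) :=
  Algebra.adjoin ℂ
    ({F | ∃ (f : Base k → ℂ) (hf : ∀ y : V, AnalyticAt ℂ f y), F = fun y : V => mulOp (y : Base k) (germ (y : Base k) f (hf y))}
      ∪ {F | ∃ i : Fin k, F = fun y : V => pderivOp (y : Base k) i})

/-- Restriction of families of germs of differential operators. -/
def resFam {k : ℕ} {V U : TopologicalSpace.Opens (Base k)} (h : V ≤ U) :
    (∀ y : U, DStalk (y : Base k)) →ₐ[ℂ] (∀ y : V, DStalk (y : Base k)) where
  toFun s y := s ⟨y, h y.2⟩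
  map_one' := rfl
  map_mul' _ _ := rfl
  map_zero' := rfl
  map_add' _ _ := rfl
  commutes' _ := rfl

theorem resFam_mem_DPre {k : ℕ} {V U : TopologicalSpace.Opens (Base k)} (h : V ≤ U)
    {s : ∀ y : U, DStalk (y : Base k)} (hs : s ∈ DPre U) : resFam h s ∈ DPre V := by
  have h1 : (DPre U).map (resFam h) ≤ DPre V := by
    rw [DPre, AlgHom.map_adjoin]
    refine Algebra.adjoin_mono ?_
    rintro _ ⟨F, hF, rfl⟩
    rcases hF with ⟨f, hf, rfl⟩ | ⟨i, rfl⟩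
    · exact Or.inl ⟨f, fun y => hf ⟨y, h y.2⟩, rfl⟩
    · exact Or.inr ⟨i, rfl⟩
  exact h1 ⟨s, hs, rfl⟩

/-- The algebra `D_N(U)` of sections over `U` of the sheaf `D_N` of holomorphic differential
operators: families of germs that are locally given by a differential operator with holomorphic
coefficients. -/
def DSec {k : ℕ} (U : TopologicalSpace.Opens (Base k)) :
    Subalgebra ℂ (∀ y : U, DStalk (y : Base k)) where
  carrier := {s | ∀ x ∈ U, ∃ V : TopologicalSpace.Opens (Base k), x ∈ V ∧
    ∃ h : V ≤ U, resFam h s ∈ DPre V}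
  mul_mem' := by
    intro s t hs ht x hx
    obtain ⟨V, hV, h, hsV⟩ := hs x hx
    obtain ⟨W, hW, h', htW⟩ := ht x hx
    exact ⟨V ⊓ W, ⟨hV, hW⟩, inf_le_left.trans h,
      mul_mem (resFam_mem_DPre inf_le_left hsV) (resFam_mem_DPre inf_le_right htW)⟩
  add_mem' := by
    intro s t hs ht x hx
    obtain ⟨V, hV, h, hsV⟩ := hs x hx
    obtain ⟨W, hW, h', htW⟩ := ht x hx
    exact ⟨V ⊓ W, ⟨hV, hW⟩, inf_le_left.trans h,
      add_mem (resFam_mem_DPre inf_le_left hsV) (resFam_mem_DPre inf_le_right htW)⟩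
  algebraMap_mem' := fun r x hx => ⟨U, hx, le_rfl, (DPre U).algebraMap_mem r⟩

theorem DPre_le_DSec {k : ℕ} (U : TopologicalSpace.Opens (Base k)) : DPre U ≤ DSec U :=
  fun _ hs _ hx => ⟨U, hx, le_rfl, hs⟩

/-- Restriction of sections of `D_N`. -/
def resD {k : ℕ} {V U : TopologicalSpace.Opens (Base k)} (h : V ≤ U) (s : DSec U) : DSec V :=
  ⟨resFam h s, fun x hx => by
    obtain ⟨W, hW, h', hs⟩ := s.2 x (h hx)
    exact ⟨W ⊓ V, ⟨hW, hx⟩, inf_le_right, resFam_mem_DPre inf_le_left hs⟩⟩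

/-- The `D_N(U)`-module `𝒩_{μ,l}(U)` of sections over `U` of the quotient sheaf
`𝒩_{μ,l} = D_N / 𝒥_{μ,l}`: families of elements of the stalks that are locally the class of a
section of `D_N`. -/
def NSec {k : ℕ} (μ l : ℂ) (U : TopologicalSpace.Opens (Base k)) :
    Submodule (DSec U) (∀ y : U, NStalk μ l (y : Base k)) where
  carrier := {n | ∀ x ∈ U, ∃ V : TopologicalSpace.Opens (Base k), x ∈ V ∧
    ∃ (h : V ≤ U) (P : DSec V), ∀ y : V,
      n ⟨y, h y.2⟩ = (idealJ μ l (y : Base k)).mkQ ((P : ∀ y : V, DStalk (y : Base k)) y)}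
  add_mem' := by
    intro n n' hn hn' x hx
    obtain ⟨V, hV, h, P, hP⟩ := hn x hx
    obtain ⟨W, hW, h', Q, hQ⟩ := hn' x hx
    refine ⟨V ⊓ W, ⟨hV, hW⟩, inf_le_left.trans h,
      resD inf_le_left P + resD inf_le_right Q, fun y => ?_⟩
    exact congrArg₂ (· + ·) (hP ⟨y, y.2.1⟩) (hQ ⟨y, y.2.2⟩)
  zero_mem' := fun _ hx => ⟨U, hx, le_rfl, 0, fun _ => rfl⟩
  smul_mem' := by
    intro s n hn x hx
    obtain ⟨V, hV, h, P, hP⟩ := hn x hx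
    refine ⟨V, hV, h, resD h s * P, fun y => ?_⟩
    exact congrArg (fun z => (s : ∀ y : U, DStalk (y : Base k)) ⟨y, h y.2⟩ • z) (hP y)

/-- Restriction of sections of `𝒩_{μ,l}`. -/
def resN {k : ℕ} (μ l : ℂ) {V U : TopologicalSpace.Opens (Base k)} (h : V ≤ U)
    (n : NSec μ l U) : NSec μ l V :=
  ⟨fun y => (n : ∀ y : U, NStalk μ l (y : Base k)) ⟨y, h y.2⟩, fun x hx => by
    obtain ⟨W, hW, h', P, hP⟩ := n.2 x (h hx)
    exact ⟨W ⊓ V, ⟨hW, hx⟩, inf_le_right, resD inf_le_left P, fun y => hP ⟨y, y.2.1⟩⟩⟩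

/-- The class in `𝒩_{μ,l}(U)` of a section of `D_N` over `U`. -/
def cls {k : ℕ} (μ l : ℂ) {U : TopologicalSpace.Opens (Base k)} (P : DSec U) : NSec μ l U :=
  ⟨fun y => (idealJ μ l (y : Base k)).mkQ ((P : ∀ y : U, DStalk (y : Base k)) y),
    fun _ hx => ⟨U, hx, le_rfl, P, fun _ => rfl⟩⟩

theorem sig_mem {k : ℕ} (U : TopologicalSpace.Opens (Base k)) (h : ℕ) :
    (fun y : U => sig (y : Base k) h) ∈ DSec U := by
  by_cases hh : 1 ≤ h ∧ h ≤ k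
  · simp only [sig, dif_pos hh]
    exact DPre_le_DSec U (Algebra.subset_adjoin (Or.inl
      ⟨fun z => z ⟨h - 1, by omega⟩, fun y => analyticAt_coord _ _, rfl⟩))
  · simp only [sig, dif_neg hh]
    exact zero_mem (DSec U)

theorem del_mem {k : ℕ} (U : TopologicalSpace.Opens (Base k)) (h : ℕ) :
    (fun y : U => del (y : Base k) h) ∈ DSec U := by
  by_cases hh : 1 ≤ h ∧ h ≤ k
  · simp only [del, dif_pos hh]
    exact DPre_le_DSec U (Algebra.subset_adjoin (Or.inr ⟨⟨h - 1, by omega⟩, rfl⟩))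
  · simp only [del, dif_neg hh]
    exact zero_mem (DSec U)

/-- The section of `D_N` over `U` given by the operator `E + μ`. -/
def EAdd {k : ℕ} (μ : ℂ) (U : TopologicalSpace.Opens (Base k)) : DSec U :=
  ⟨fun y => opE (y : Base k) + algebraMap ℂ (DStalk (y : Base k)) μ, by
    have h1 : (fun y : U => opE (y : Base k)) =
        ∑ h ∈ Finset.Icc 1 k, (fun y : U => sig (y : Base k) h) * (fun y : U => del (y : Base k) h) := by
      funext y
      rw [Finset.sum_apply]
      rfl
    have h2 : (fun y : U => opE (y : Base k)) ∈ DSec U := by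
      rw [h1]
      exact sum_mem fun h _ => mul_mem (sig_mem U h) (del_mem U h)
    exact add_mem h2 ((DSec U).algebraMap_mem μ)⟩

end MuTrace

end

/-! Call a vector killed by the `A_{i,j}`, the `T^m_μ` and `U_0 - l` a solution for `μ`. Since `∂_h
(E + c) = (E + c + 1) ∂_h`, the operator `E + μ` sends solutions for `μ` to solutions for `μ + 1`,
so the map is well defined.

A solution `u` can be recovered from `w = (E + μ) u`. The `A_{i,j}` make `∂_i ∂_j u = y_{i+j}`
depend only on `i + j`, and the `T^m_μ` give `y_m = -∂_m w` for `2 ≤ m ≤ k`. For `m = k + H`, `1 ≤ H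
≤ k`, the operator `k E - U_0 = ∑ (k - j) σ_j ∂_j`, which has no `∂_k` term, expresses `(l + k μ + k
- H) y_m` through `w` and the `y_q` with `q < m`; the hypothesis on `l + k μ` makes these scalars
nonzero. Then `U_0 = l - h` on `∂_h u` and `U_0 = l` on `u` yield `∂_h u` and `u`, as `l ∉ ℕ`.

Read as a membership statement, this is `mem_of_euler_mem` and gives surjectivity. Read as a
construction of `u` from any solution `w` for `μ + 1`, it is `exists_solution` and gives
injectivity. Both are proved in a module over an arbitrary ring with Weyl relations, so that they
apply to stalks and to rings of sections alike. -/

namespace MuTrace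

/-! ### Weyl relations and Euler operators -/

section Weyl

set_option linter.unusedSectionVars false

variable {R M : Type*} [Ring R] [Algebra ℂ R] [AddCommGroup M] [Module ℂ M] [Module R M]
  [IsScalarTower ℂ R M]

/-- Two families `s_h`, `d_h` (`1 ≤ h ≤ k`) of elements of a ring satisfying the commutation
relations of the coordinates and of the partial derivatives. -/
structure IsWeylSystem (k : ℕ) (s d : ℕ → R) : Prop where
  d_comm : ∀ i j, d i * d j = d j * d i
  s_comm : ∀ i j, s i * s j = s j * s i
  d_mul_s : ∀ i ∈ Finset.Icc 1 k, ∀ j ∈ Finset.Icc 1 k,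
    d i * s j = s j * d i + if i = j then 1 else 0

/-- The weighted Euler operator `∑ a_h s_h d_h`. -/
def euler (k : ℕ) (s d : ℕ → R) (a : ℕ → ℂ) : R :=
  ∑ h ∈ Finset.Icc 1 k, a h • (s h * d h)

/-- The vector `u` is annihilated by the operators `A_{i,j}`, `T^m_μ` and `U_0 - l`. -/
structure IsTraceSolution (k : ℕ) (s d : ℕ → R) (μ l : ℂ) (u : M) : Prop where
  d_d : ∀ i j, 1 ≤ i → i + 1 ≤ k → 2 ≤ j → j ≤ k → d i • d j • u = d (i + 1) • d (j - 1) • u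
  d_euler : ∀ m, 2 ≤ m → m ≤ k →
    d 1 • d (m - 1) • u + d m • (euler k s d 1 • u + μ • u) = 0
  euler_id : euler k s d (fun h => (h : ℂ)) • u = l • u

theorem euler_smul (k : ℕ) (s d : ℕ → R) (a : ℕ → ℂ) (m : M) :
    euler k s d a • m = ∑ h ∈ Finset.Icc 1 k, a h • s h • d h • m := by
  simp only [euler, Finset.sum_smul, smul_assoc, mul_smul]

namespace IsWeylSystem

variable {k : ℕ} {s d : ℕ → R}

theorem d_smul_comm (W : IsWeylSystem k s d) (i j : ℕ) (m : M) : d i • d j • m = d j • d i • m := by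
  rw [smul_smul, W.d_comm, mul_smul]

theorem s_smul_comm (W : IsWeylSystem k s d) (i j : ℕ) (m : M) : s i • s j • m = s j • s i • m := by
  rw [smul_smul, W.s_comm, mul_smul]

theorem d_smul_s_smul (W : IsWeylSystem k s d)
    {i j : ℕ} (hi : i ∈ Finset.Icc 1 k) (hj : j ∈ Finset.Icc 1 k) (m : M) :
    d i • s j • m = s j • d i • m + if i = j then m else 0 := by
  rw [smul_smul, W.d_mul_s i hi j hj, add_smul, mul_smul]
  split_ifs <;> simp

theorem d_smul_sum (W : IsWeylSystem k s d)
    {i : ℕ} (hi : i ∈ Finset.Icc 1 k) (a : ℕ → ℂ) (y : ℕ → M) :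
    d i • ∑ h ∈ Finset.Icc 1 k, a h • s h • y h =
      ∑ h ∈ Finset.Icc 1 k, a h • s h • d i • y h + a i • y i := by
  have : ∀ h ∈ Finset.Icc 1 k, d i • a h • s h • y h =
      a h • s h • d i • y h + if i = h then a h • y h else 0 := by
    intro h hh
    rw [smul_comm (d i), W.d_smul_s_smul hi hh, smul_add]
    split_ifs <;> simp
  rw [Finset.smul_sum, Finset.sum_congr rfl this, Finset.sum_add_distrib, Finset.sum_ite_eq,
    if_pos hi]

theorem d_smul_euler_smul (W : IsWeylSystem k s d)
    {i : ℕ} (hi : i ∈ Finset.Icc 1 k) (a : ℕ → ℂ) (m : M) :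
    d i • euler k s d a • m = euler k s d a • d i • m + a i • d i • m := by
  rw [euler_smul, euler_smul, W.d_smul_sum hi a fun h => d h • m]
  simp only [W.d_smul_comm i]

theorem euler_smul_d_smul (W : IsWeylSystem k s d)
    {i : ℕ} (hi : i ∈ Finset.Icc 1 k) (a : ℕ → ℂ) (m : M) :
    euler k s d a • d i • m = d i • euler k s d a • m - a i • d i • m := by
  rw [W.d_smul_euler_smul hi, add_sub_cancel_right]

theorem euler_smul_s_smul (W : IsWeylSystem k s d)
    {i : ℕ} (hi : i ∈ Finset.Icc 1 k) (a : ℕ → ℂ) (m : M) :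
    euler k s d a • s i • m = s i • euler k s d a • m + a i • s i • m := by
  have : ∀ h ∈ Finset.Icc 1 k, a h • s h • d h • s i • m =
      s i • a h • s h • d h • m + if i = h then a h • s h • m else 0 := by
    intro h hh
    rw [W.d_smul_s_smul hh hi, smul_add, smul_add, smul_comm (s i) (a h), W.s_smul_comm i h]
    simp only [eq_comm (a := h)]
    split_ifs <;> simp
  rw [euler_smul, euler_smul, Finset.sum_congr rfl this, Finset.sum_add_distrib,
    Finset.sum_ite_eq, if_pos hi, Finset.smul_sum]

theorem euler_smul_comm (W : IsWeylSystem k s d) (a b : ℕ → ℂ) (m : M) :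
    euler k s d a • euler k s d b • m = euler k s d b • euler k s d a • m := by
  rw [euler_smul k s d b, euler_smul k s d b, Finset.smul_sum]
  refine Finset.sum_congr rfl fun i hi => ?_
  rw [smul_comm _ (b i), W.euler_smul_s_smul hi, W.euler_smul_d_smul hi, smul_sub,
    smul_comm (s i) (a i), sub_add_cancel]

/-- The combination `k E - U_0` is chosen so that the term in `d k` drops out. -/
theorem sum_sub_smul (m : M) :
    ∑ j ∈ Finset.Icc 1 k, ((k : ℂ) - j) • s j • d j • m =
      (k : ℂ) • euler k s d 1 • m - euler k s d (fun h => (h : ℂ)) • m := by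
  simp only [euler_smul, sub_smul, Finset.sum_sub_distrib, Pi.one_apply, one_smul,
    Finset.smul_sum]

theorem sum_Ico_sub_smul (hk : 1 ≤ k) (f : ℕ → M) :
    ∑ j ∈ Finset.Ico 1 k, ((k : ℂ) - j) • f j = ∑ j ∈ Finset.Icc 1 k, ((k : ℂ) - j) • f j := by
  rw [← Finset.Ico_insert_right hk, Finset.sum_insert (by simp)]
  simp

/-! ### Towers of candidate second derivatives -/

/-- The condition on a sequence of vectors `y_1, …, y_n` to behave like the second derivatives
`y_{i+j} = d_i d_j u` of a solution `u`, the vector `y_1` being `- d_1 (E + μ) u`. -/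
structure IsTower (k : ℕ) (s d : ℕ → R) (μ l : ℂ) (n : ℕ) (y : ℕ → M) : Prop where
  euler_id : ∀ p, 1 ≤ p → p ≤ n → euler k s d (fun h => (h : ℂ)) • y p = (l - p) • y p
  d_symm : ∀ i p i' p', 1 ≤ i → i ≤ k → 1 ≤ i' → i' ≤ k → 1 ≤ p → p ≤ n → 1 ≤ p' → p' ≤ n →
    i + p = i' + p' → d i • y p = d i' • y p'
  euler_one : ∀ q i, 1 ≤ q → 1 ≤ i → i ≤ k → q + i ≤ n →
    euler k s d 1 • y (q + i) = -((μ + 2) • y (q + i)) - d i • y q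

/-- Both `E` and `U_0` are known on `y (q + i)`, hence so is `k E - U_0`. For `i = k` this becomes
the recursion that determines `y (k + q)`. -/
theorem IsTower.sum_eq {μ l : ℂ} {n : ℕ} {y : ℕ → M} (Y : IsTower k s d μ l n y)
    {q i : ℕ} (hq : 1 ≤ q) (hi : 1 ≤ i) (hik : i ≤ k) (hn : q + i ≤ n) :
    (k : ℂ) • d i • y q + ∑ j ∈ Finset.Icc 1 k, ((k : ℂ) - j) • s j • d j • y (q + i) =
      -((k * (μ + 2) + (l - (q + i))) • y (q + i)) := by
  rw [sum_sub_smul, Y.euler_one q i hq hi hik hn, Y.euler_id _ (by omega) hn]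
  push_cast
  generalize d i • y q = a
  module

/-- Each `A_{i,j}` moves one unit between the two indices; iterate `n` times. -/
theorem smul_d_eq_of_solution {ν l : ℂ} {w : M} (hw : IsTraceSolution k s d ν l w) (n : ℕ) :
    ∀ i j, 1 ≤ i → i + n ≤ k → 1 ≤ j → j + n ≤ k →
      d i • d (j + n) • w = d (i + n) • d j • w := by
  induction n with
  | zero => intros; rfl
  | succ n ih =>
    intro i j hi hin hj hjn
    rw [hw.d_d i (j + (n + 1)) hi (by omega) (by omega) hjn]
    have := ih (i + 1) j (by omega) (by omega) hj (by omega)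
    rw [show j + (n + 1) - 1 = j + n by omega, this]
    congr 2
    omega

theorem smul_d_symm {ν l : ℂ} {w : M} (hw : IsTraceSolution k s d ν l w) {i j i' j' : ℕ}
    (hi : 1 ≤ i) (hik : i ≤ k) (hj : 1 ≤ j) (hjk : j ≤ k) (hi' : 1 ≤ i') (hik' : i' ≤ k)
    (hj' : 1 ≤ j') (hjk' : j' ≤ k) (h : i + j = i' + j') :
    d i • d j • w = d i' • d j' • w := by
  rcases le_total i i' with h1 | h1
  · obtain ⟨n, rfl⟩ := Nat.exists_eq_add_of_le h1
    obtain rfl : j = j' + n := by omega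
    exact smul_d_eq_of_solution hw n i j' hi hik' hj' hjk
  · obtain ⟨n, rfl⟩ := Nat.exists_eq_add_of_le h1
    obtain rfl : j' = j + n := by omega
    exact (smul_d_eq_of_solution hw n i' j hi' hik hj hjk').symm

/-- The relation `T^m_{μ+1}` for `w`, with `d m` moved past `E`, is exactly the rule for `E` on the
tower. -/
theorem isTower_of_solution (W : IsWeylSystem k s d)
    {μ l : ℂ} {w : M} (hw : IsTraceSolution k s d (μ + 1) l w) :
    IsTower k s d μ l k fun p => -(d p • w) where
  euler_id p hp hpk := by
    rw [smul_neg, W.euler_smul_d_smul (Finset.mem_Icc.2 ⟨hp, hpk⟩), hw.euler_id, smul_comm (d p)]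
    generalize d p • w = a
    module
  d_symm i p i' p' hi hik hi' hik' hp hpk hp' hpk' h := by
    rw [smul_neg, smul_neg, smul_d_symm hw hi hik hp hpk hi' hik' hp' hpk' h]
  euler_one q i hq hi hik hn := by
    have hT := hw.d_euler (q + i) (by omega) hn
    have hA := smul_d_symm hw (i := i) (j := q) (i' := 1) (j' := q + i - 1) hi hik hq (by omega)
      le_rfl (by omega) (by omega) (by omega) (by omega)
    rw [← hA, smul_add, W.d_smul_euler_smul (Finset.mem_Icc.2 ⟨by omega, hn⟩),
      smul_comm (d (q + i)), Pi.one_apply, one_smul] at hT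
    simp only [smul_neg]
    generalize euler k s d 1 • d (q + i) • w = a at *
    generalize d i • d q • w = b at *
    generalize d (q + i) • w = c at *
    linear_combination (norm := module) (-1 : ℂ) • hT

theorem IsTower.congr {μ l : ℂ} {n : ℕ} {y y' : ℕ → M} (Y : IsTower k s d μ l n y)
    (h : ∀ p, p ≤ n → y' p = y p) : IsTower k s d μ l n y' where
  euler_id p hp hpn := by rw [h p hpn, Y.euler_id p hp hpn]
  d_symm i p i' p' hi hik hi' hik' hp hpn hp' hpn' e := by
    rw [h p hpn, h p' hpn', Y.d_symm i p i' p' hi hik hi' hik' hp hpn hp' hpn' e]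
  euler_one q i hq hi hik hn := by
    rw [h _ hn, h q (by omega), Y.euler_one q i hq hi hik hn]

/-- A tower of length `k + h` extends by one step once the new vector is given by the recursion. -/
theorem IsTower.succ (W : IsWeylSystem k s d) {μ l : ℂ} {H : ℕ} {y : ℕ → M} (hk : 1 ≤ k)
    (hH : 1 ≤ H) (hc : l + k * μ + k - H ≠ 0)
    (Y : IsTower k s d μ l (k + H - 1) y)
    (hy : (l + k * μ + k - H) • y (k + H) = -((k : ℂ) • d k • y H +
      ∑ j ∈ Finset.Ico 1 k, ((k : ℂ) - j) • s j • d k • y (H + j))) :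
    IsTower k s d μ l (k + H) y := by
  have hkk : k ∈ Finset.Icc 1 k := Finset.mem_Icc.2 ⟨hk, le_rfl⟩
  have hkC : (k : ℂ) ≠ 0 := by exact_mod_cast (by omega : k ≠ 0)
  have mem : ∀ {j}, j ∈ Finset.Ico 1 k → j ∈ Finset.Icc 1 k := fun hj =>
    Finset.mem_Icc.2 ⟨(Finset.mem_Ico.1 hj).1, (Finset.mem_Ico.1 hj).2.le⟩
  have hd : ∀ i, 1 ≤ i → i < k → d i • y (k + H) = d k • y (H + i) := by
    intro i hi hik
    have hiI : i ∈ Finset.Icc 1 k := Finset.mem_Icc.2 ⟨hi, hik.le⟩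
    -- At `j = k` the index `H + k` lies outside the known tower, but the coefficient `k - j`
    -- vanishes.
    have e1 : ∀ j ∈ Finset.Icc 1 k, ((k : ℂ) - j) • s j • d i • d k • y (H + j) =
        ((k : ℂ) - j) • s j • d k • d j • y (H + i) := by
      intro j hj
      rcases (Finset.mem_Icc.1 hj).2.lt_or_eq with hjk | rfl
      · rw [W.d_smul_comm i k, Y.d_symm i (H + j) j (H + i) hi hik.le (Finset.mem_Icc.1 hj).1
          hjk.le (by omega) (by omega) (by omega) (by omega) (by omega)]
      · simp
    -- Compare `d k` of the known relation at `(H, i)` with `d i` of the recursion: the sums agree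
    -- by `e1`, and the commutator term `(k - i) d_k y_{H+i}` adjusts the scalar to that of the
    -- recursion.
    have h2 := congrArg (d k • ·) (Y.sum_eq hH hi hik.le (by omega))
    have h3 := congrArg (d i • ·) hy
    simp only [smul_add, smul_neg, smul_comm (d k) (_ : ℂ), smul_comm (d i) (_ : ℂ)] at h2 h3
    rw [W.d_smul_sum hkk (fun j => (k : ℂ) - j) fun j => d j • y (H + i)] at h2
    rw [sum_Ico_sub_smul hk, W.d_smul_sum hiI (fun j => (k : ℂ) - j) fun j => d k • y (H + j),
      Finset.sum_congr rfl e1, W.d_smul_comm i k] at h3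
    apply smul_right_injective M hc
    simp only [sub_self, zero_smul, add_zero] at h2 h3 ⊢
    rw [h3]
    generalize d k • y (H + i) = a at *
    generalize d k • d i • y H = b at *
    linear_combination (norm := module) (-1 : ℂ) • h2
  -- Every term of the recursion has `U_0`-weight `l - (k + H)`.
  have hU : euler k s d (fun h => (h : ℂ)) • y (k + H) = (l - (k + H : ℕ)) • y (k + H) := by
    have h3 := congrArg (euler k s d (fun h => (h : ℂ)) • ·) hy
    have e1 : ∀ j ∈ Finset.Ico 1 k, euler k s d (fun h => (h : ℂ)) • ((k : ℂ) - j) • s j • d k • y (H + j)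
        = (l - (k + H : ℕ)) • ((k : ℂ) - j) • s j • d k • y (H + j) := by
      intro j hj
      rw [smul_comm _ ((k : ℂ) - j), W.euler_smul_s_smul (mem hj), W.euler_smul_d_smul hkk,
        Y.euler_id _ (by omega) (by have := Finset.mem_Ico.1 hj; omega), smul_comm (d k),
        ← sub_smul, smul_comm (s j)]
      generalize s j • d k • y (H + j) = a
      push_cast
      module
    have e2 : euler k s d (fun h => (h : ℂ)) • d k • y H = (l - (k + H : ℕ)) • d k • y H := by
      rw [W.euler_smul_d_smul hkk, Y.euler_id _ hH (by omega), smul_comm (d k)]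
      generalize d k • y H = a
      push_cast
      module
    simp only [smul_neg, smul_add] at h3
    rw [smul_comm _ (k : ℂ), e2, Finset.smul_sum, Finset.sum_congr rfl e1, ← Finset.smul_sum,
      smul_comm _ (l + k * μ + k - H)] at h3
    apply smul_right_injective M hc
    simp only
    rw [h3, smul_comm (l + k * μ + k - H) (l - (k + H : ℕ)), hy]
    generalize d k • y H = a
    module
  -- By `hd`, the sum in the recursion is `(k E - U_0) y_{k+H}`; solve for `E`.
  have hE : euler k s d 1 • y (k + H) = -((μ + 2) • y (k + H)) - d k • y H := by
    have e1 : ∑ j ∈ Finset.Ico 1 k, ((k : ℂ) - j) • s j • d k • y (H + j) =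
        (k : ℂ) • euler k s d 1 • y (k + H) - (l - (k + H : ℕ)) • y (k + H) := by
      rw [← hU, ← sum_sub_smul, ← sum_Ico_sub_smul hk]
      refine Finset.sum_congr rfl fun j hj => ?_
      rw [hd j (Finset.mem_Ico.1 hj).1 (Finset.mem_Ico.1 hj).2]
    rw [e1] at hy
    apply smul_right_injective M hkC
    simp only
    push_cast at hy
    generalize d k • y H = a at *
    generalize euler k s d 1 • y (k + H) = b at *
    linear_combination (norm := module) hy
  refine ⟨fun p hp hpn => ?_, ?_, ?_⟩
  · rcases hpn.lt_or_eq with h | rfl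
    · exact Y.euler_id p hp (by omega)
    · exact hU
  · have key : ∀ i i' p', 1 ≤ i → i ≤ k → 1 ≤ i' → i' ≤ k → 1 ≤ p' → p' ≤ k + H →
        i + (k + H) = i' + p' → d i • y (k + H) = d i' • y p' := by
      intro i i' p' hi hik hi' hik' hp' hpn' e
      rcases hpn'.lt_or_eq with h | rfl
      · rw [hd i hi (by omega), Y.d_symm k (H + i) i' p' hk le_rfl hi' hik' (by omega) (by omega)
          hp' (by omega) (by omega)]
      · rw [show i = i' by omega]
    intro i p i' p' hi hik hi' hik' hp hpn hp' hpn' e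
    rcases hpn.lt_or_eq with h | rfl
    · rcases hpn'.lt_or_eq with h' | rfl
      · exact Y.d_symm i p i' p' hi hik hi' hik' hp (by omega) hp' (by omega) e
      · exact (key i' i p hi' hik' hi hik hp hpn e.symm).symm
    · exact key i i' p' hi hik hi' hik' hp' hpn' e
  · intro q i hq hi hik hn
    rcases hn.lt_or_eq with h | h
    · exact Y.euler_one q i hq hi hik (by omega)
    · rw [h, hE, Y.d_symm k H i q hk le_rfl hi hik hH (by omega) hq (by omega) (by omega)]

theorem exists_isTower (W : IsWeylSystem k s d) {μ l : ℂ} (hk : 1 ≤ k)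
    (hlμ : ∀ j : ℕ, j < k → l + k * μ ≠ -j) {w : M}
    (hw : IsTraceSolution k s d (μ + 1) l w) :
    ∃ y : ℕ → M, (∀ p ≤ k, y p = -(d p • w)) ∧ IsTower k s d μ l (k + k) y := by
  suffices ∀ n ≤ k, ∃ y : ℕ → M, (∀ p ≤ k, y p = -(d p • w)) ∧ IsTower k s d μ l (k + n) y from
    this k le_rfl
  intro n
  induction n with
  | zero => exact fun _ => ⟨_, fun p _ => rfl, W.isTower_of_solution hw⟩
  | succ n ih =>
    intro hn
    obtain ⟨y, hyw, Y⟩ := ih (by omega)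
    have hc : l + k * μ + k - (n + 1 : ℕ) ≠ 0 := by
      intro h
      -- The scalar for `H = n + 1` vanishes only if `l + k μ = -(k - H)`, and `0 ≤ k - H < k`.
      refine hlμ (k - (n + 1)) (by omega) ?_
      rw [Nat.cast_sub hn]
      linear_combination h
    set v : M := (l + k * μ + k - (n + 1 : ℕ))⁻¹ • -((k : ℂ) • d k • y (n + 1) +
        ∑ j ∈ Finset.Ico 1 k, ((k : ℂ) - j) • s j • d k • y (n + 1 + j)) with hv
    set y' : ℕ → M := Function.update y (k + (n + 1)) v with hy'
    have hlow : ∀ p, p ≤ k + n → y' p = y p := fun p hp =>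
      Function.update_of_ne (by omega) _ _
    refine ⟨y', fun p hp => by rw [hlow p (by omega), hyw p hp],
      (Y.congr hlow).succ W hk (by omega) hc ?_⟩
    have e : ∑ j ∈ Finset.Ico 1 k, ((k : ℂ) - j) • s j • d k • y' (n + 1 + j) =
        ∑ j ∈ Finset.Ico 1 k, ((k : ℂ) - j) • s j • d k • y (n + 1 + j) :=
      Finset.sum_congr rfl fun j hj => by
        rw [hlow _ (by have := Finset.mem_Ico.1 hj; omega)]
    rw [e, hlow (n + 1) (by omega), hy', Function.update_self, hv, smul_inv_smul₀ hc]

/-- The linear relations between the vectors of a tower. -/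
theorem IsTower.sum_relation (W : IsWeylSystem k s d) {μ l : ℂ} {y : ℕ → M} (hk : 1 ≤ k)
    (Y : IsTower k s d μ l (k + k) y) {H : ℕ} (hH : 1 ≤ H) (hHk : H ≤ k) :
    (l - H) • y H + ∑ j ∈ Finset.Icc 1 k, (l - H + (μ + 1) * j) • s j • y (H + j) = 0 := by
  have hkC : (k : ℂ) ≠ 0 := by exact_mod_cast (by omega : k ≠ 0)
  -- Apply `∑ i s_i` to the relations `sum_eq` at `(H, i)` and evaluate in two ways. In `h2`, the
  -- symmetry `d_j y_{H+i} = d_i y_{H+j}` rebuilds `U_0` on `y_{H+j}`. All coefficients of the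
  -- difference are divisible by `k`.
  have h1 : ∑ i ∈ Finset.Icc 1 k, (i : ℂ) • s i • ((k : ℂ) • d i • y H +
      ∑ j ∈ Finset.Icc 1 k, ((k : ℂ) - j) • s j • d j • y (H + i)) =
      ∑ i ∈ Finset.Icc 1 k, -((i * (k * (μ + 2) + (l - (H + i)))) • s i • y (H + i)) := by
    refine Finset.sum_congr rfl fun i hi => ?_
    have hi' := Finset.mem_Icc.1 hi
    rw [Y.sum_eq hH hi'.1 hi'.2 (by omega), smul_neg, smul_neg, smul_comm (s i), smul_smul]
  have h2 : ∑ i ∈ Finset.Icc 1 k, (i : ℂ) • s i • ((k : ℂ) • d i • y H +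
      ∑ j ∈ Finset.Icc 1 k, ((k : ℂ) - j) • s j • d j • y (H + i)) =
      (k : ℂ) • (l - H) • y H +
        ∑ j ∈ Finset.Icc 1 k, (((k : ℂ) - j) * (l - (H + j))) • s j • y (H + j) := by
    simp only [smul_add, Finset.sum_add_distrib]
    congr 1
    · rw [← Y.euler_id H hH (by omega), euler_smul, Finset.smul_sum]
      refine Finset.sum_congr rfl fun i _ => ?_
      rw [smul_comm (s i), smul_comm (i : ℂ)]
    · simp only [Finset.smul_sum]
      rw [Finset.sum_comm]
      refine Finset.sum_congr rfl fun j hj => ?_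
      have hj' := Finset.mem_Icc.1 hj
      have e := Y.euler_id (H + j) (by omega) (by omega)
      rw [mul_smul, smul_comm (l - (H + j : ℂ)), ← Nat.cast_add, ← e, euler_smul,
        Finset.smul_sum, Finset.smul_sum]
      refine Finset.sum_congr rfl fun i hi => ?_
      have hi' := Finset.mem_Icc.1 hi
      rw [smul_comm (s i), smul_comm (i : ℂ), W.s_smul_comm i j, smul_comm (s j) (i : ℂ),
        Y.d_symm j (H + i) i (H + j) (by omega) (by omega) (by omega) (by omega) (by omega)
        (by omega) (by omega) (by omega) (by omega)]
  have h3 := h2.symm.trans h1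
  rw [Finset.sum_neg_distrib, eq_neg_iff_add_eq_zero, add_assoc, ← Finset.sum_add_distrib] at h3
  apply smul_right_injective M hkC
  simp only
  rw [smul_zero, smul_add, Finset.smul_sum, ← h3]
  congr 1
  refine Finset.sum_congr rfl fun j _ => ?_
  generalize s j • y (H + j) = a
  module

/-! ### Recovering a solution from its image under `E + μ` -/

theorem exists_solution (W : IsWeylSystem k s d) {μ l : ℂ} (hk : 1 ≤ k)
    (hl : ∀ n : ℕ, l ≠ n) (hlμ : ∀ j : ℕ, j < k → l + k * μ ≠ -j) {w : M}
    (hw : IsTraceSolution k s d (μ + 1) l w) :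
    ∃ u : M, IsTraceSolution k s d μ l u ∧ euler k s d 1 • u + μ • u = w := by
  have hl' : ∀ n : ℕ, l - n ≠ 0 := fun n => sub_ne_zero.2 (hl n)
  have hl0 : l ≠ 0 := by simpa using hl 0
  obtain ⟨y, hyw, Y⟩ := W.exists_isTower hk hlμ hw
  -- `p h` is to be `d h • u`: its `U_0`-weight must be `l - h` and its derivatives the `y (h + j)`.
  set p : ℕ → M := fun h : ℕ => (l - h)⁻¹ • ∑ j ∈ Finset.Icc 1 k, (j : ℂ) • s j • y (h + j)
  have hpy : ∀ h : ℕ, (l - h) • p h = ∑ j ∈ Finset.Icc 1 k, (j : ℂ) • s j • y (h + j) := fun h =>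
    smul_inv_smul₀ (hl' h) _
  have hdp : ∀ i ∈ Finset.Icc 1 k, ∀ h ∈ Finset.Icc 1 k, d i • p h = y (h + i) := by
    intro i hi h hh
    have hi' := Finset.mem_Icc.1 hi
    have hh' := Finset.mem_Icc.1 hh
    apply smul_right_injective M (hl' h)
    simp only
    rw [← smul_comm (d i), hpy, W.d_smul_sum hi (fun j => (j : ℂ)) fun j => y (h + j)]
    have e : ∀ j ∈ Finset.Icc 1 k, (j : ℂ) • s j • d i • y (h + j) =
        (j : ℂ) • s j • d j • y (h + i) := by
      intro j hj
      have hj' := Finset.mem_Icc.1 hj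
      rw [Y.d_symm i (h + j) j (h + i) (by omega) (by omega) (by omega) (by omega) (by omega)
        (by omega) (by omega) (by omega) (by omega)]
    rw [Finset.sum_congr rfl e, ← euler_smul k s d (fun j => (j : ℂ)), Y.euler_id _ (by omega)
      (by omega)]
    push_cast
    module
  set u : M := l⁻¹ • ∑ h ∈ Finset.Icc 1 k, (h : ℂ) • s h • p h
  have hlu : l • u = ∑ h ∈ Finset.Icc 1 k, (h : ℂ) • s h • p h := smul_inv_smul₀ hl0 _
  clear_value u
  have hdu : ∀ i ∈ Finset.Icc 1 k, d i • u = p i := by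
    intro i hi
    apply smul_right_injective M hl0
    simp only
    rw [← smul_comm (d i), hlu, W.d_smul_sum hi (fun j => (j : ℂ)) p]
    have e : ∀ j ∈ Finset.Icc 1 k, (j : ℂ) • s j • d i • p j = (j : ℂ) • s j • y (i + j) := by
      intro j hj
      rw [hdp i hi j hj, add_comm]
    rw [Finset.sum_congr rfl e, ← hpy]
    module
  have hUu : euler k s d (fun h => (h : ℂ)) • u = l • u := by
    rw [euler_smul, hlu]
    exact Finset.sum_congr rfl fun j hj => by rw [hdu j hj]
  have hddu : ∀ i ∈ Finset.Icc 1 k, ∀ j ∈ Finset.Icc 1 k, d i • d j • u = y (j + i) :=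
    fun i hi j hj => by rw [hdu j hj, hdp i hi j hj]
  -- After multiplication by `l - h`, this is `sum_relation` at `H = h`.
  have hdw : ∀ h ∈ Finset.Icc 1 k, d h • (euler k s d 1 • u + μ • u) = d h • w := by
    intro h hh
    have hh' := Finset.mem_Icc.1 hh
    have hyh : d h • w = -y h := by rw [hyw h hh'.2, neg_neg]
    rw [hyh, smul_add, W.d_smul_euler_smul hh, smul_comm (d h) μ, hdu h hh, euler_smul,
      Pi.one_apply, one_smul]
    apply smul_right_injective M (hl' h)
    have hr := Y.sum_relation W hk hh'.1 hh'.2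
    have e : ∑ j ∈ Finset.Icc 1 k, (l - h + (μ + 1) * j) • s j • y (h + j) =
        (l - h) • ∑ j ∈ Finset.Icc 1 k, (1 : ℕ → ℂ) j • s j • d j • p h +
          (μ + 1) • (l - h) • p h := by
      rw [hpy, Finset.smul_sum, Finset.smul_sum, ← Finset.sum_add_distrib]
      refine Finset.sum_congr rfl fun j hj => ?_
      rw [hdp j hj h hh, Pi.one_apply, add_smul, mul_smul, one_smul]
    rw [e] at hr
    simp only
    generalize ∑ j ∈ Finset.Icc 1 k, (1 : ℕ → ℂ) j • s j • d j • p h = a at *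
    linear_combination (norm := module) hr
  -- Both sides have the same derivatives and the same nonzero `U_0`-eigenvalue `l`, so the Euler
  -- formula identifies them.
  have hw' : euler k s d 1 • u + μ • u = w := by
    apply smul_right_injective M hl0
    have e : euler k s d (fun h => (h : ℂ)) • (euler k s d 1 • u + μ • u) =
        l • (euler k s d 1 • u + μ • u) := by
      rw [smul_add, W.euler_smul_comm, smul_comm _ μ, hUu, smul_comm _ l, smul_comm μ l, smul_add]
    simp only
    rw [← e, ← hw.euler_id, euler_smul k s d (fun h => (h : ℂ)),
      euler_smul k s d (fun h => (h : ℂ))]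
    exact Finset.sum_congr rfl fun j hj => by rw [hdw j hj]
  refine ⟨u, ⟨?_, ?_, hUu⟩, hw'⟩
  · intro i j hi hik hj hjk
    rw [hddu i (Finset.mem_Icc.2 ⟨hi, by omega⟩) j (Finset.mem_Icc.2 ⟨by omega, hjk⟩),
      hddu (i + 1) (Finset.mem_Icc.2 ⟨by omega, by omega⟩) (j - 1)
        (Finset.mem_Icc.2 ⟨by omega, by omega⟩)]
    congr 1
    omega
  · intro m hm hmk
    rw [hw', hddu 1 (Finset.mem_Icc.2 ⟨le_rfl, by omega⟩) (m - 1)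
        (Finset.mem_Icc.2 ⟨by omega, by omega⟩), Nat.sub_add_cancel (by omega), hyw m hmk,
      neg_add_cancel]

/-- If `u` is a solution, then `u` belongs to any submodule containing `(E + μ) u`. -/
theorem mem_of_euler_mem (W : IsWeylSystem k s d) {μ l : ℂ} (hk : 1 ≤ k)
    (hl : ∀ n : ℕ, l ≠ n) (hlμ : ∀ j : ℕ, j < k → l + k * μ ≠ -j) {u : M}
    (hu : IsTraceSolution k s d μ l u) (N : Submodule R M)
    (hN : euler k s d 1 • u + μ • u ∈ N) : u ∈ N := by
  have cancel : ∀ {c : ℂ} {x : M}, c ≠ 0 → c • x ∈ N → x ∈ N := fun {c x} hc hx => by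
    rw [← inv_smul_smul₀ hc x]
    exact N.smul_of_tower_mem _ hx
  have sum_mem' : ∀ (a : ℕ → ℂ) (y : ℕ → M), (∀ j ∈ Finset.Icc 1 k, a j = 0 ∨ y j ∈ N) →
      ∑ j ∈ Finset.Icc 1 k, a j • s j • y j ∈ N := fun a y h => N.sum_mem fun j hj => by
    rcases h j hj with h0 | h0
    · rw [h0, zero_smul]
      exact N.zero_mem
    · exact N.smul_of_tower_mem _ (N.smul_mem _ h0)
  have key : ∀ n i j, i + j = n → 1 ≤ i → i ≤ k → 1 ≤ j → j ≤ k → d i • d j • u ∈ N := by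
    intro n
    induction n using Nat.strong_induction_on with
    | _ n ih =>
    rintro i j rfl hi hik hj hjk
    rcases le_or_gt (i + j) k with h | h
    · rw [smul_d_symm hu hi hik hj hjk le_rfl (by omega) (by omega : 1 ≤ i + j - 1) (by omega)
        (by omega), eq_neg_of_add_eq_zero_left (hu.d_euler (i + j) (by omega) h)]
      exact N.neg_mem (N.smul_mem _ hN)
    · obtain ⟨h, hij⟩ := Nat.exists_eq_add_of_lt h
      have hkk : k ∈ Finset.Icc 1 k := Finset.mem_Icc.2 ⟨hk, le_rfl⟩
      have hhk : h + 1 ∈ Finset.Icc 1 k := Finset.mem_Icc.2 ⟨by omega, by omega⟩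
      rw [smul_d_symm hu hi hik hj hjk hk le_rfl (by omega : 1 ≤ h + 1) (by omega) (by omega)]
      -- Put `H = h + 1`. The difference of `h1` and `h2` is `(l + k μ + k - H) d_k d_H u`: the
      -- parts in `E` cancel. In `h2`, the induction applies for `j < k` because `j + H < k + H`.
      have h1 : (k : ℂ) • d k • d (h + 1) • (euler k s d 1 • u + μ • u) ∈ N :=
        N.smul_of_tower_mem _ (N.smul_mem _ (N.smul_mem _ hN))
      have h2 : ∑ j ∈ Finset.Icc 1 k, ((k : ℂ) - j) • s j • d j • d k • d (h + 1) • u ∈ N := by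
        refine sum_mem' _ (fun j => d j • d k • d (h + 1) • u) fun m hm => ?_
        have hm' := Finset.mem_Icc.1 hm
        rcases hm'.2.lt_or_eq with hmk | rfl
        · right
          rw [W.d_smul_comm m k]
          exact N.smul_mem _ (ih (m + (h + 1)) (by omega) m (h + 1) rfl hm'.1 hm'.2 (by omega)
            (by omega))
        · left
          exact sub_self _
      rw [sum_sub_smul, W.euler_smul_d_smul hkk (fun h => (h : ℂ)),
        W.euler_smul_d_smul hhk (fun h => (h : ℂ)), hu.euler_id, smul_sub,
        smul_comm (d (h + 1)) l, smul_comm (d k) l, smul_comm (d k) ((h + 1 : ℕ) : ℂ)] at h2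
      rw [smul_add (d (h + 1)), W.d_smul_euler_smul hhk, smul_add (d k), smul_add (d k),
        W.d_smul_euler_smul hkk, smul_comm (d (h + 1)) μ, smul_comm (d k) μ] at h1
      simp only [Pi.one_apply, one_smul] at h1
      have hc : l + k * μ + k - (h + 1 : ℕ) ≠ 0 := by
        intro h0
        refine hlμ (k - (h + 1)) (by omega) ?_
        rw [Nat.cast_sub (by omega)]
        linear_combination h0
      refine cancel hc ?_
      have h3 := N.sub_mem h1 h2
      generalize d k • d (h + 1) • u = a at *
      generalize euler k s d 1 • a = b at *
      convert h3 using 1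
      push_cast
      module
  have hd : ∀ h ∈ Finset.Icc 1 k, d h • u ∈ N := by
    intro h hh
    have hh' := Finset.mem_Icc.1 hh
    have e : (l - h) • d h • u = euler k s d (fun h => (h : ℂ)) • d h • u := by
      rw [W.euler_smul_d_smul hh, hu.euler_id, smul_comm (d h), sub_smul]
    refine cancel (sub_ne_zero.2 (hl h)) ?_
    rw [e, euler_smul]
    refine sum_mem' _ (fun j => d j • d h • u) fun j hj => Or.inr ?_
    have hj' := Finset.mem_Icc.1 hj
    exact key _ j h rfl hj'.1 hj'.2 hh'.1 hh'.2
  refine cancel (by simpa using hl 0 : l ≠ 0) ?_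
  rw [← hu.euler_id, euler_smul]
  exact sum_mem' _ (fun j => d j • u) fun j hj => Or.inr (hd j hj)

end IsWeylSystem

end Weyl

/-! ### The stalks of `D_N` and of the quotient modules -/

section Stalk

variable {k : ℕ} {x : Base k}

theorem pderiv_mul_comm (i j : Fin k) : pderiv x i * pderiv x j = pderiv x j * pderiv x i := by
  refine LinearMap.ext ?_
  rintro ⟨_, f, hf, rfl⟩
  refine Subtype.ext (Filter.Germ.coe_eq.2 ?_)
  filter_upwards [hf.eventually_analyticAt] with y hy
  have hd : DifferentiableAt ℂ (fderiv ℂ f) y := hy.fderiv.differentiableAt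
  have key : ∀ v w : Base k, fderiv ℂ (fun z => fderiv ℂ f z v) y w =
      fderiv ℂ (fderiv ℂ f) y w v := fun v w => by
    rw [fderiv_clm_apply hd (differentiableAt_const v)]
    simp
  have hsymm : IsSymmSndFDerivAt ℂ f y :=
    (hy.contDiffAt (n := ⊤)).isSymmSndFDerivAt (by simp)
  change fderiv ℂ (fun z => fderiv ℂ f z _) y _ = fderiv ℂ (fun z => fderiv ℂ f z _) y _
  rw [key, key]
  exact hsymm _ _

theorem pderiv_mul_mulLeft_coord (i j : Fin k) :
    pderiv x i * LinearMap.mulLeft ℂ (germ x _ (analyticAt_coord x j)) =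
      LinearMap.mulLeft ℂ (germ x _ (analyticAt_coord x j)) * pderiv x i +
        if i = j then 1 else 0 := by
  refine LinearMap.ext ?_
  rintro ⟨_, f, hf, rfl⟩
  have key : ∀ᶠ y in 𝓝 x, fderiv ℂ (fun z : Base k => z j * f z) y (Pi.single i 1) =
      y j * fderiv ℂ f y (Pi.single i 1) + (if i = j then 1 else 0) * f y := by
    filter_upwards [hf.eventually_analyticAt] with y hy
    have hc : HasFDerivAt (fun z : Base k => z j)
        (ContinuousLinearMap.proj (R := ℂ) (φ := fun _ : Fin k => ℂ) j) y :=
      (ContinuousLinearMap.proj (R := ℂ) (φ := fun _ : Fin k => ℂ) j).hasFDerivAt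
    rw [(hc.fun_mul hy.differentiableAt.hasFDerivAt).fderiv]
    simp [Pi.single_apply, eq_comm, mul_comm]
  refine Subtype.ext ?_
  split_ifs with h
  · refine Filter.Germ.coe_eq.2 ?_
    filter_upwards [key] with y hy
    rw [if_pos h, one_mul] at hy
    exact hy
  · refine Filter.Germ.coe_eq.2 ?_
    filter_upwards [key] with y hy
    rw [if_neg h, zero_mul] at hy
    exact hy

theorem isWeylSystem_stalk (x : Base k) : IsWeylSystem k (sig x) (del x) where
  d_comm i j := by
    unfold del
    split_ifs
    · exact Subtype.ext (pderiv_mul_comm _ _)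
    all_goals simp
  s_comm i j := by
    unfold sig
    split_ifs
    · refine Subtype.ext (LinearMap.ext fun φ => ?_)
      exact mul_left_comm _ _ φ
    all_goals simp
  d_mul_s i hi j hj := by
    have hi' := Finset.mem_Icc.1 hi
    have hj' := Finset.mem_Icc.1 hj
    rw [del, sig, dif_pos hi', dif_pos hj']
    refine Subtype.ext ((pderiv_mul_mulLeft_coord _ _).trans ?_)
    by_cases h : i = j
    · subst h
      simp only [if_true]
      rfl
    · have h' : ¬ ((⟨i - 1, by omega⟩ : Fin k) = ⟨j - 1, by omega⟩) := by
        rw [Fin.mk.injEq]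
        omega
      rw [if_neg h, if_neg h']
      rfl

theorem opE_eq_euler (x : Base k) : opE x = euler k (sig x) (del x) 1 := by
  simp [opE, euler]

theorem opU0_eq_euler (x : Base k) :
    opU0 x = euler k (sig x) (del x) fun h => (h : ℂ) := rfl

end Stalk

/-- Moving `E + c` to the left of one derivative raises `c` by `1`. In `T^m`, both terms thus become
`E + μ + 2` applied to the terms of the original relation, and these cancel. -/
theorem IsTraceSolution.euler_add_smul {R M : Type*} [Ring R] [Algebra ℂ R] [AddCommGroup M]
    [Module ℂ M] [Module R M] [IsScalarTower ℂ R M] {k : ℕ} {s d : ℕ → R}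
    (W : IsWeylSystem k s d) {μ l : ℂ} {u : M} (hu : IsTraceSolution k s d μ l u) :
    IsTraceSolution k s d (μ + 1) l (euler k s d 1 • u + μ • u) := by
  have hd : ∀ i ∈ Finset.Icc 1 k, ∀ v : M, ∀ c : ℂ, d i • (euler k s d 1 • v + c • v) =
      euler k s d 1 • d i • v + (c + 1) • d i • v := by
    intro i hi v c
    rw [smul_add, W.d_smul_euler_smul hi, smul_comm (d i) c, Pi.one_apply, one_smul, add_smul, one_smul]
    abel
  refine ⟨fun i j hi hik hj hjk => ?_, fun m hm hmk => ?_, ?_⟩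
  · rw [hd j (Finset.mem_Icc.2 ⟨by omega, hjk⟩), hd i (Finset.mem_Icc.2 ⟨hi, by omega⟩),
      hd (j - 1) (Finset.mem_Icc.2 ⟨by omega, by omega⟩),
      hd (i + 1) (Finset.mem_Icc.2 ⟨by omega, hik⟩), hu.d_d i j hi hik hj hjk]
  · have hT := hu.d_euler m hm hmk
    set v := euler k s d 1 • u + μ • u with hv
    rw [hd m (Finset.mem_Icc.2 ⟨by omega, hmk⟩), hv,
      hd (m - 1) (Finset.mem_Icc.2 ⟨by omega, by omega⟩),
      hd 1 (Finset.mem_Icc.2 ⟨le_rfl, by omega⟩), ← hv, eq_neg_of_add_eq_zero_right hT]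
    simp only [smul_neg]
    rw [show μ + 1 + 1 = μ + (1 + 1) from add_assoc _ _ _]
    abel
  · rw [smul_add, W.euler_smul_comm, smul_comm _ μ, hu.euler_id, smul_comm _ l, smul_comm μ l,
      smul_add]

section Stalk

variable {k : ℕ} {x : Base k}

theorem smul_eq_zero_of_mem_idealJ {M : Type*} [AddCommGroup M] [Module ℂ M]
    [Module (DStalk x) M] [IsScalarTower ℂ (DStalk x) M] {μ l : ℂ} {u : M}
    (hu : IsTraceSolution k (sig x) (del x) μ l u) {P : DStalk x} (hP : P ∈ idealJ μ l x) :
    P • u = 0 := by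
  suffices idealJ μ l x ≤ LinearMap.ker (LinearMap.toSpanSingleton (DStalk x) M u) from
    LinearMap.mem_ker.1 (this hP)
  refine sup_le (sup_le (Submodule.span_le.2 ?_) (Submodule.span_le.2 ?_))
    (Submodule.span_le.2 ?_)
  · rintro _ ⟨i, j, hi, hik, hj, hjk, rfl⟩
    change opA x i j • u = 0
    rw [opA, sub_smul, mul_smul, mul_smul, hu.d_d i j hi hik hj hjk, sub_self]
  · rintro _ ⟨m, hm, hmk, rfl⟩
    change opT μ x m • u = 0
    rw [opT, add_smul, mul_smul, mul_smul, add_smul, algebraMap_smul, opE_eq_euler,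
      hu.d_euler m hm hmk]
  · rintro _ rfl
    change (opU0 x - algebraMap ℂ (DStalk x) l) • u = 0
    rw [sub_smul, algebraMap_smul, opU0_eq_euler, hu.euler_id, sub_self]

/-- The class of `1` in the stalk of `𝒩_{μ,l}`. -/
noncomputable def genN (μ l : ℂ) (x : Base k) : NStalk μ l x := (idealJ μ l x).mkQ 1

theorem smul_genN (μ l : ℂ) (P : DStalk x) : P • genN μ l x = (idealJ μ l x).mkQ P := by
  rw [genN, ← map_smul, smul_eq_mul, mul_one]

theorem smul_genN_eq_zero (μ l : ℂ) (P : DStalk x) :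
    P • genN μ l x = 0 ↔ P ∈ idealJ μ l x := by
  rw [smul_genN, Submodule.mkQ_apply, Submodule.Quotient.mk_eq_zero]

theorem isTraceSolution_genN (μ l : ℂ) (x : Base k) :
    IsTraceSolution k (sig x) (del x) μ l (genN μ l x) where
  d_d i j hi hik hj hjk := by
    rw [← sub_eq_zero, ← mul_smul, ← mul_smul, ← sub_smul, smul_genN_eq_zero]
    exact Submodule.mem_sup_left (Submodule.mem_sup_left
      (Submodule.subset_span ⟨i, j, hi, hik, hj, hjk, rfl⟩))
  d_euler m hm hmk := by
    rw [← algebraMap_smul (DStalk x) μ, ← add_smul, ← mul_smul, ← mul_smul, ← add_smul,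
      smul_genN_eq_zero, ← opE_eq_euler]
    exact Submodule.mem_sup_left (Submodule.mem_sup_right
      (Submodule.subset_span ⟨m, hm, hmk, rfl⟩))
  euler_id := by
    rw [← sub_eq_zero, ← algebraMap_smul (DStalk x) l, ← sub_smul, smul_genN_eq_zero]
    exact Submodule.mem_sup_right (Submodule.subset_span rfl)

theorem opE_add_smul_genN (μ l : ℂ) (x : Base k) :
    (opE x + algebraMap ℂ (DStalk x) μ) • genN μ l x =
      euler k (sig x) (del x) 1 • genN μ l x + μ • genN μ l x := by
  rw [add_smul, algebraMap_smul, opE_eq_euler]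

/-- The morphism `𝒩_{μ+1,l} → 𝒩_{μ,l}` induced on the stalks by the right multiplication by
`E + μ`. -/
noncomputable def stalkShift (μ l : ℂ) (x : Base k) : NStalk (μ + 1) l x →ₗ[DStalk x] NStalk μ l x :=
  (idealJ (μ + 1) l x).liftQ
    (LinearMap.toSpanSingleton (DStalk x) _ ((opE x + algebraMap ℂ (DStalk x) μ) • genN μ l x))
    fun P hP => by
      rw [opE_add_smul_genN]
      exact smul_eq_zero_of_mem_idealJ
        ((isTraceSolution_genN μ l x).euler_add_smul (isWeylSystem_stalk x)) hP

theorem stalkShift_mkQ (μ l : ℂ) (P : DStalk x) :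
    stalkShift μ l x ((idealJ (μ + 1) l x).mkQ P) =
      P • (opE x + algebraMap ℂ (DStalk x) μ) • genN μ l x := rfl

/-- A solution `u` for `μ` inside the stalk for `μ + 1` with `(E + μ) u = [1]` gives the left
inverse `[P] ↦ P u`. -/
theorem stalkShift_injective (hk : 1 ≤ k) {μ l : ℂ} (hl : ∀ n : ℕ, l ≠ n)
    (hlμ : ∀ j : ℕ, j < k → l + k * μ ≠ -j) (x : Base k) :
    Function.Injective (stalkShift μ l x) := by
  rw [injective_iff_map_eq_zero]
  intro a ha
  obtain ⟨P, rfl⟩ := Submodule.mkQ_surjective _ a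
  obtain ⟨u, hu, huw⟩ := (isWeylSystem_stalk x).exists_solution hk hl hlμ
    (isTraceSolution_genN (μ + 1) l x)
  rw [stalkShift_mkQ, ← mul_smul, smul_genN_eq_zero] at ha
  have h := smul_eq_zero_of_mem_idealJ hu ha
  rwa [mul_smul, add_smul, algebraMap_smul, opE_eq_euler, huw, smul_genN] at h

end Stalk

/-! ### Passage to sections -/

section Sheaf

variable {k : ℕ} (U : TopologicalSpace.Opens (Base k))

/-- The coordinates as sections of `D_N`. -/
noncomputable def sigSec (h : ℕ) : DSec U := ⟨_, sig_mem U h⟩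

/-- The partial derivatives as sections of `D_N`. -/
noncomputable def delSec (h : ℕ) : DSec U := ⟨_, del_mem U h⟩

theorem isWeylSystem_sections : IsWeylSystem k (sigSec U) (delSec U) where
  d_comm i j := Subtype.ext (funext fun y => (isWeylSystem_stalk (y : Base k)).d_comm i j)
  s_comm i j := Subtype.ext (funext fun y => (isWeylSystem_stalk (y : Base k)).s_comm i j)
  d_mul_s i hi j hj := Subtype.ext (funext fun y => by
    refine ((isWeylSystem_stalk (y : Base k)).d_mul_s i hi j hj).trans ?_
    split_ifs <;> rfl)

instance isScalarTower_sections (μ l : ℂ) :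
    IsScalarTower ℂ (DSec U) (∀ y : U, NStalk μ l (y : Base k)) :=
  ⟨fun c P n => funext fun y =>
    smul_assoc c ((P : ∀ y : U, DStalk (y : Base k)) y) (n y)⟩

theorem euler_sections_smul_apply {μ l : ℂ} (a : ℕ → ℂ) (n : ∀ y : U, NStalk μ l (y : Base k))
    (y : U) : (euler k (sigSec U) (delSec U) a • n) y =
      euler k (sig (y : Base k)) (del (y : Base k)) a • n y := by
  rw [euler_smul]
  refine (congrFun (euler_smul k (sigSec U) (delSec U) a n) y).trans ?_
  rw [Finset.sum_apply]
  rfl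

theorem isTraceSolution_sections (μ l : ℂ) :
    IsTraceSolution k (sigSec U) (delSec U) μ l fun y : U => genN μ l (y : Base k) where
  d_d i j hi hik hj hjk := funext fun y =>
    (isTraceSolution_genN μ l (y : Base k)).d_d i j hi hik hj hjk
  d_euler m hm hmk := funext fun y => by
    refine Eq.trans ?_ ((isTraceSolution_genN μ l (y : Base k)).d_euler m hm hmk)
    rw [← euler_sections_smul_apply U 1 fun y : U => genN μ l (y : Base k)]
    rfl
  euler_id := funext fun y => by
    rw [euler_sections_smul_apply]
    exact (isTraceSolution_genN μ l (y : Base k)).euler_id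

/-- Working over the ring of sections, in the product of the stalks, produces a single `Q` on all of
`U` with `Q (E + μ) ≡ 1`, rather than one germ for each point. -/
theorem exists_section_smul_eq (hk : 1 ≤ k) {μ l : ℂ} (hl : ∀ n : ℕ, l ≠ n)
    (hlμ : ∀ j : ℕ, j < k → l + k * μ ≠ -j) :
    ∃ Q : DSec U, ∀ y : U, (Q : ∀ y : U, DStalk (y : Base k)) y •
      (opE (y : Base k) + algebraMap ℂ (DStalk (y : Base k)) μ) • genN μ l (y : Base k) =
        genN μ l (y : Base k) := by
  have h := (isWeylSystem_sections U).mem_of_euler_mem hk hl hlμ (isTraceSolution_sections U μ l)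
    _ (Submodule.mem_span_singleton_self (R := DSec U) _)
  obtain ⟨Q, hQ⟩ := Submodule.mem_span_singleton.1 h
  refine ⟨Q, fun y => ?_⟩
  refine Eq.trans ?_ (congrFun hQ y)
  rw [opE_add_smul_genN, ← euler_sections_smul_apply U 1 fun y : U => genN μ l (y : Base k)]
  rfl

/-- The morphism `𝒩_{μ+1,l}(U) → 𝒩_{μ,l}(U)` induced by the right multiplication by `E + μ`. -/
noncomputable def shift (μ l : ℂ) : NSec (μ + 1) l U →ₗ[DSec U] NSec μ l U where
  toFun n := ⟨fun y => stalkShift μ l (y : Base k)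
      ((n : ∀ y : U, NStalk (μ + 1) l (y : Base k)) y), fun x hx => by
    obtain ⟨V, hV, h, P, hP⟩ := n.2 x hx
    refine ⟨V, hV, h, P * EAdd μ V, fun y => ?_⟩
    refine (congrArg (stalkShift μ l (y : Base k)) (hP y)).trans ?_
    rw [stalkShift_mkQ, ← mul_smul, smul_genN]
    rfl⟩
  map_add' n n' := Subtype.ext (funext fun y => map_add (stalkShift μ l (y : Base k)) _ _)
  map_smul' P n := Subtype.ext (funext fun y => map_smul (stalkShift μ l (y : Base k))
    ((P : ∀ y : U, DStalk (y : Base k)) y) _)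

theorem shift_cls (μ l : ℂ) (P : DSec U) :
    shift U μ l (cls (μ + 1) l P) = cls μ l (P * EAdd μ U) :=
  Subtype.ext (funext fun y => by
    refine (stalkShift_mkQ μ l _).trans ?_
    rw [← mul_smul, smul_genN]
    rfl)

theorem shift_bijective (hk : 1 ≤ k) {μ l : ℂ} (hl : ∀ n : ℕ, l ≠ n)
    (hlμ : ∀ j : ℕ, j < k → l + k * μ ≠ -j) : Function.Bijective (shift U μ l) := by
  refine ⟨fun n n' h => Subtype.ext (funext fun y => ?_), fun n => ?_⟩
  · exact stalkShift_injective hk hl hlμ (y : Base k) (congrFun (congrArg Subtype.val h) y)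
  · obtain ⟨Q, hQ⟩ := exists_section_smul_eq U hk hl hlμ
    have key : ∀ (y : U) (P : DStalk (y : Base k)), stalkShift μ l (y : Base k)
        ((idealJ (μ + 1) l (y : Base k)).mkQ (P * (Q : ∀ y : U, DStalk (y : Base k)) y)) =
          (idealJ μ l (y : Base k)).mkQ P := fun y P => by
      rw [stalkShift_mkQ, mul_smul, hQ y, smul_genN]
    have hex : ∀ y : U, ∃ m, stalkShift μ l (y : Base k) m =
        (n : ∀ y : U, NStalk μ l (y : Base k)) y := fun y => by
      obtain ⟨P, hP⟩ := Submodule.mkQ_surjective _ ((n : ∀ y : U, NStalk μ l (y : Base k)) y)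
      exact ⟨_, (key y P).trans hP⟩
    choose m hm using hex
    -- The stalkwise preimages form a section: where `n` is the class of `P`, injectivity forces `m`
    -- to be the class of `P Q`.
    refine ⟨⟨m, fun x hx => ?_⟩, Subtype.ext (funext hm)⟩
    obtain ⟨V, hV, h, P, hP⟩ := n.2 x hx
    refine ⟨V, hV, h, P * resD h Q, fun y => ?_⟩
    apply stalkShift_injective hk hl hlμ (y : Base k)
    exact ((hm ⟨y, h y.2⟩).trans (hP y)).trans (key ⟨y, h y.2⟩ _).symm

end Sheaf

end MuTrace

theorem theorem4p2p1 (k : ℕ) (hk : 1 ≤ k) (μ l : ℂ) (hμ : μ ≠ 0)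
    (hl : ∀ n : ℕ, l ≠ (n : ℂ))
    (hlμ : ∀ j : ℕ, j < k → l + (k : ℂ) * μ ≠ -(j : ℂ)) :
    ∃ e : ∀ U : TopologicalSpace.Opens (MuTrace.Base k),
        MuTrace.NSec (μ + 1) l U ≃ₗ[MuTrace.DSec U] MuTrace.NSec μ l U,
      (∀ (U V : TopologicalSpace.Opens (MuTrace.Base k)) (h : V ≤ U)
          (n : MuTrace.NSec (μ + 1) l U),
        e V (MuTrace.resN (μ + 1) l h n) = MuTrace.resN μ l h (e U n)) ∧
      (∀ (U : TopologicalSpace.Opens (MuTrace.Base k)) (P : MuTrace.DSec U),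
        e U (MuTrace.cls (μ + 1) l P) = MuTrace.cls μ l (P * MuTrace.EAdd μ U)) :=
  ⟨fun U => LinearEquiv.ofBijective (MuTrace.shift U μ l) (MuTrace.shift_bijective U hk hl hlμ),
    fun _ _ _ _ => rfl, fun U P => MuTrace.shift_cls U μ l P⟩
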